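/- For $t,n\in\mathbb{N}_0$ with $t\ge 1$ let $\operatorname{c}_t(n)$ denote the number of $t$-core partitions of $n$ (partitions in whose Ferrers--Young diagram no hook length is divisible by $t$), and let $\operatorname{sc}_t(n)$ denote the number of those that are self-conjugate. Then there are no arithmetic progressions on which $\operatorname{c}_3$ and $\operatorname{sc}_5$ are non-trivially integer multiples of one another, even asymptotically. That is, let $M_1,M_2\ge 1$ and $m_1,m_2\ge 0$ be integers such that the sequences $$f(n)=\operatorname{c}_3(M_1n+m_1),\qquad g(n)=\operatorname{sc}_5(M_2n+m_2)\qquad(n\ge 0)$$ are not both identically zero, and let $k\neq 0$ be an integer. Then none of the following holds, and none of them holds with $f$ and $g$ interchanged: 1. $f(n)=k\,g(n)$ for all $n\ge 0$; 2. $f(n)\sim k\,g(n)$ as $n\to\infty$, in the sense that $f(n)-k\,g(n)=o(k\,g(n))$; 3. $g(n)\ne 0$ for infinitely many $n$, and $f(n)/g(n)\to k$ as $n\to\infty$ through the integers $n$ with $g(n)\neq 0$. -/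

import Mathlib

/-- The hook length of the cell `(i, j)`, with rows and columns numbered from `0`. With rows and
columns numbered from `1` it reads `λ_j + λ'_k - k - j + 1`. There is no truncation in the
subtraction when `(i, j)` is a cell of `μ`, since then `j < μ.rowLen i` and `i < μ.colLen j`. -/
def YoungDiagram.hookLength (μ : YoungDiagram) (i j : ℕ) : ℕ :=
  μ.rowLen i + μ.colLen j - (i + j + 1)

/-- `μ` is a `t`-core if no hook length of a cell of `μ` is divisible by `t`. -/
def YoungDiagram.IsCore (t : ℕ) (μ : YoungDiagram) : Prop :=
  ∀ i j : ℕ, (i, j) ∈ μ → ¬ t ∣ μ.hookLength i j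

/-- The number of `t`-core partitions of `n`; partitions are identified with their
Ferrers--Young diagrams. -/
noncomputable def coreCount (t n : ℕ) : ℕ :=
  {μ : YoungDiagram | μ.card = n ∧ μ.IsCore t}.ncard

/-- The number of self-conjugate `t`-core partitions of `n`. -/
noncomputable def selfConjCoreCount (t n : ℕ) : ℕ :=
  {μ : YoungDiagram | μ.card = n ∧ μ.IsCore t ∧ μ.transpose = μ}.ncard

/-- There are finitely many Young diagrams with `n` cells, so the two cardinalities above are
those of finite sets. -/
theorem YoungDiagram.finite_card_eq (n : ℕ) : {μ : YoungDiagram | μ.card = n}.Finite := by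
  refine Set.Finite.of_finite_image (f := YoungDiagram.cells) ?_
    (fun μ _ ν _ h => YoungDiagram.ext h)
  refine ((Finset.range n ×ˢ Finset.range n).powerset.finite_toSet).subset ?_
  rintro _ ⟨μ, hμ, rfl⟩
  simp only [Finset.coe_powerset, Set.mem_preimage, Set.mem_powerset_iff, Finset.coe_subset]
  rintro ⟨i, j⟩ hc
  have hμ' : μ.cells.card = n := hμ
  have h1 : i < μ.colLen j := YoungDiagram.mem_iff_lt_colLen.1 hc
  have h2 : j < μ.rowLen i := YoungDiagram.mem_iff_lt_rowLen.1 hc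
  have h3 : μ.colLen j ≤ n := by
    rw [YoungDiagram.colLen_eq_card, ← hμ']
    exact Finset.card_le_card (Finset.filter_subset _ _)
  have h4 : μ.rowLen i ≤ n := by
    rw [YoungDiagram.rowLen_eq_card, ← hμ']
    exact Finset.card_le_card (Finset.filter_subset _ _)
  simp only [Finset.mem_product, Finset.mem_range]
  omega

/-- `f` is asymptotically `k` times `g`, in the sense of ratios: `g n ≠ 0` for infinitely many
`n`, and `f n / g n` tends to `k` as `n → ∞` through the indices with `g n ≠ 0`. Nothing is
required of `f` at the zeros of `g`. -/
def RatioTendsTo (f g : ℕ → ℕ) (k : ℤ) : Prop :=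
  (∃ᶠ n in Filter.atTop, g n ≠ 0) ∧
    Filter.Tendsto (fun n => (f n : ℝ) / (g n : ℝ))
      (Filter.atTop ⊓ Filter.principal {n | g n ≠ 0}) (nhds (k : ℝ))

/-- `f` is `k` times `g` exactly, or asymptotically: either `f ~ k g` in the sense
`f - k g = o(k g)`, or in the more permissive sense of ratios. -/
def IsMultipleEvenAsymptotically (f g : ℕ → ℕ) (k : ℤ) : Prop :=
  (∀ n, (f n : ℤ) = k * (g n : ℤ)) ∨
  Asymptotics.IsEquivalent Filter.atTop (fun n => (f n : ℝ)) (fun n => (k : ℝ) * (g n : ℝ)) ∨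
  RatioTendsTo f g k

/-! The obstruction is the zeros. If either sequence is nonzero somewhere, there are arbitrarily
large `n` at which it is nonzero while the other vanishes, and this contradicts every form of
proportionality, since `k ≠ 0`.

Non-vanishing is arithmetic. A `t`-core is encoded by one integer per residue class modulo `t`, and
its size is quadratic in these integers. Completing squares, 3-cores of `n` exist iff `3n + 1` is a
value of `x² + xy + y²`, and self-conjugate 5-cores exist iff `5(n + 1)` is a sum of two squares in
prescribed classes modulo 5 (`coreCount_three_ne_zero_iff`, `selfConjCoreCount_five_ne_zero_iff`).

A prime that is 5 modulo 12 splits in the Gaussian integers and is inert in the Eisenstein integers;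
for 7 modulo 12 the roles are reversed. Starting from a nonzero value at `n₀`,
`exists_large_progression` uses Dirichlet's theorem to multiply the number to be represented by a
norm that is 1 modulo 60, so it stays represented, while a prime inert for the other form divides
the other number exactly once, so that one is not represented. -/

/-- The boundary path of `μ`, read off in two complementary sequences of integers: the vertical
steps are `s 0 > s 1 > ⋯` and the horizontal steps are `s' 0 < s' 1 < ⋯`, and `(i, j)` is a cell
of `μ` if and only if `s' j < s i`. -/
structure YoungDiagram.IsBoundary (μ : YoungDiagram) (s s' : ℕ → ℤ) : Prop where
  anti : StrictAnti s
  mono : StrictMono s'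
  compl : Set.range s' = (Set.range s)ᶜ
  mem_iff : ∀ i j, (i, j) ∈ μ ↔ s' j < s i

/-! ### Boundary sequences: hooks, cores and size -/

namespace YoungDiagram

theorem isBoundary_rowLen_colLen (μ : YoungDiagram) :
    μ.IsBoundary (fun i => (μ.rowLen i : ℤ) - i - 1) (fun j => (j : ℤ) - μ.colLen j) := by
  have hs : StrictAnti fun i : ℕ => (μ.rowLen i : ℤ) - i - 1 := by
    intro a b hab
    have := μ.rowLen_anti a b hab.le
    simp only
    omega
  have hm : ∀ i j, (i, j) ∈ μ ↔ (j : ℤ) - μ.colLen j < (μ.rowLen i : ℤ) - i - 1 := by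
    intro i j
    have h1 := μ.mem_iff_lt_colLen (i := i) (j := j)
    have h2 := μ.mem_iff_lt_rowLen (i := i) (j := j)
    by_cases h : (i, j) ∈ μ
    · simp only [h, true_iff] at h1 h2 ⊢
      omega
    · simp only [h, false_iff] at h1 h2 ⊢
      omega
  have hne : ∀ i j : ℕ, (j : ℤ) - μ.colLen j ≠ (μ.rowLen i : ℤ) - i - 1 := by
    intro i j
    have h1 := μ.mem_iff_lt_colLen (i := i) (j := j)
    have h2 := μ.mem_iff_lt_rowLen (i := i) (j := j)
    by_cases h : (i, j) ∈ μ
    · simp only [h, true_iff] at h1 h2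
      omega
    · simp only [h, false_iff] at h1 h2
      omega
  refine ⟨hs, ?_, ?_, hm⟩
  · intro a b hab
    have := μ.colLen_anti a b hab.le
    simp only
    omega
  · ext x
    simp only [Set.mem_range, Set.mem_compl_iff, not_exists]
    constructor
    · rintro ⟨j, rfl⟩ i h
      exact hne i j h.symm
    · intro hx
      -- For the first row `i` with `λ_i - i - 1 ≤ x`, column `x + i` has length exactly `i`, so it
      -- is the horizontal step at `x`.
      have hex : ∃ i : ℕ, (μ.rowLen i : ℤ) - i - 1 ≤ x := by
        refine ⟨(μ.rowLen 0 - x).toNat, ?_⟩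
        have := μ.rowLen_anti 0 (μ.rowLen 0 - x).toNat (Nat.zero_le _)
        omega
      classical
      have hspec := Nat.find_spec hex
      have hmin : ∀ i < Nat.find hex, ¬ ((μ.rowLen i : ℤ) - i - 1 ≤ x) :=
        fun i hi => Nat.find_min hex hi
      generalize Nat.find hex = i at hspec hmin
      have hlt : (μ.rowLen i : ℤ) - i - 1 < x := lt_of_le_of_ne hspec (hx i)
      refine ⟨(x + i).toNat, ?_⟩
      have h0 : ((x + i).toNat : ℤ) = x + i := by omega
      have h1 : ¬ (i, (x + i).toNat) ∈ μ := by
        rw [mem_iff_lt_rowLen]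
        omega
      rw [mem_iff_lt_colLen] at h1
      suffices i ≤ μ.colLen (x + i).toNat by omega
      rcases Nat.eq_zero_or_pos i with rfl | hi
      · exact Nat.zero_le _
      · have h2 : (i - 1, (x + i).toNat) ∈ μ := by
          have := hmin (i - 1) (by omega)
          rw [mem_iff_lt_rowLen]
          omega
        rw [mem_iff_lt_colLen] at h2
        omega

theorem exists_isBoundary {s s' : ℕ → ℤ} (hs : StrictAnti s) (hs' : StrictMono s')
    (hc : Set.range s' = (Set.range s)ᶜ) : ∃ μ : YoungDiagram, μ.IsBoundary s s' := by
  have hfin : {c : ℕ × ℕ | s' c.2 < s c.1}.Finite := by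
    refine ((Finset.range (s 0 - s' 0).toNat ×ˢ
      Finset.range (s 0 - s' 0).toNat).finite_toSet).subset ?_
    have h1 : ∀ i : ℕ, s i ≤ s 0 - i := by
      intro i
      induction i with
      | zero => simp
      | succ i ih =>
        have := hs (Nat.lt_succ_self i)
        push_cast
        simp only [Nat.succ_eq_add_one] at this
        omega
    have h2 : ∀ j : ℕ, s' 0 + j ≤ s' j := by
      intro i
      induction i with
      | zero => simp
      | succ i ih =>
        have := hs' (Nat.lt_succ_self i)
        push_cast
        simp only [Nat.succ_eq_add_one] at this
        omega
    rintro ⟨i, j⟩ hij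
    have h3 := h1 i
    have h4 := h2 j
    simp only [Set.mem_ofPred_eq] at hij
    simp only [Finset.coe_product, Finset.coe_range, Set.mem_prod, Set.mem_Iio]
    omega
  refine ⟨⟨hfin.toFinset, ?_⟩, hs, hs', hc, ?_⟩
  · rintro ⟨i, j⟩ ⟨i', j'⟩ hle h
    simp only [Set.Finite.coe_toFinset, Set.mem_ofPred_eq] at h ⊢
    exact ((hs'.monotone hle.2).trans_lt h).trans_le (hs.antitone hle.1)
  · intro i j
    rw [← mem_cells]
    simp

namespace IsBoundary

variable {μ : YoungDiagram} {s s' : ℕ → ℤ}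

theorem ne (h : μ.IsBoundary s s') (i j : ℕ) : s i ≠ s' j := by
  intro e
  have : s' j ∈ (Set.range s)ᶜ := h.compl ▸ Set.mem_range_self j
  exact this ⟨i, e⟩

theorem exists_eq_of_notMem (h : μ.IsBoundary s s') {x : ℤ} (hx : x ∉ Set.range s) :
    ∃ j, s' j = x := by
  have : x ∈ Set.range s' := by rw [h.compl]; exact hx
  exact this

/-- The boundary steps in `[s' j, s i)` are counted by the hook: the horizontal ones give the cell
and its arm, the vertical ones its leg. -/
theorem hookLength_eq (h : μ.IsBoundary s s') {i j : ℕ} (hij : (i, j) ∈ μ) :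
    (μ.hookLength i j : ℤ) = s i - s' j := by
  have key : Finset.Ico (s' j) (s i) =
      (Finset.Ico j (μ.rowLen i)).image s' ∪ (Finset.Ioo i (μ.colLen j)).image s := by
    ext x
    simp only [Finset.mem_Ico, Finset.mem_union, Finset.mem_image, Finset.mem_Ioo]
    constructor
    · rintro ⟨h1, h2⟩
      by_cases hx : x ∈ Set.range s
      · obtain ⟨k, rfl⟩ := hx
        refine Or.inr ⟨k, ⟨h.anti.lt_iff_gt.1 h2, ?_⟩, rfl⟩
        rw [← mem_iff_lt_colLen, h.mem_iff]
        exact lt_of_le_of_ne h1 (h.ne k j).symm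
      · obtain ⟨k, rfl⟩ := h.exists_eq_of_notMem hx
        refine Or.inl ⟨k, ⟨h.mono.le_iff_le.1 h1, ?_⟩, rfl⟩
        rwa [← mem_iff_lt_rowLen, h.mem_iff]
    · rintro (⟨k, ⟨h1, h2⟩, rfl⟩ | ⟨k, ⟨h1, h2⟩, rfl⟩)
      · rw [← mem_iff_lt_rowLen, h.mem_iff] at h2
        exact ⟨h.mono.monotone h1, h2⟩
      · rw [← mem_iff_lt_colLen, h.mem_iff] at h2
        exact ⟨h2.le, h.anti h1⟩
  have hd : Disjoint ((Finset.Ico j (μ.rowLen i)).image s')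
      ((Finset.Ioo i (μ.colLen j)).image s) := by
    rw [Finset.disjoint_left]
    intro x hx hx'
    obtain ⟨a, -, rfl⟩ := Finset.mem_image.1 hx
    obtain ⟨b, -, hb⟩ := Finset.mem_image.1 hx'
    exact h.ne b a hb
  have hcard := congrArg Finset.card key
  rw [Finset.card_union_of_disjoint hd, Finset.card_image_of_injective _ h.mono.injective,
    Finset.card_image_of_injective _ h.anti.injective, Int.card_Ico, Nat.card_Ico,
    Nat.card_Ioo] at hcard
  have h1 := mem_iff_lt_rowLen.1 hij
  have h2 := mem_iff_lt_colLen.1 hij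
  have h3 := (h.mem_iff i j).1 hij
  unfold hookLength
  omega

/-- A vertical step `x` with `x - t` horizontal is a hook of length `t`. Conversely, closure under
subtracting `t` makes every `s i - t * k` vertical, so none of them can be an `s' j`. -/
theorem isCore_iff (h : μ.IsBoundary s s') {t : ℕ} (ht : 0 < t) :
    μ.IsCore t ↔ ∀ x ∈ Set.range s, x - t ∈ Set.range s := by
  constructor
  · rintro hμ _ ⟨i, rfl⟩
    by_contra hx
    obtain ⟨j, hj⟩ := h.exists_eq_of_notMem hx
    have hij : (i, j) ∈ μ := by
      rw [h.mem_iff]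
      omega
    refine hμ i j hij ?_
    have := h.hookLength_eq hij
    have e : μ.hookLength i j = t := by omega
    rw [e]
  · rintro hc i j hij ⟨k, hk⟩
    have h1 := h.hookLength_eq hij
    have h2 : ∀ k : ℕ, s i - t * k ∈ Set.range s := by
      intro k
      induction k with
      | zero => simp
      | succ k ih =>
        have := hc _ ih
        push_cast
        rwa [show s i - (t : ℤ) * (k + 1) = s i - t * k - t by ring]
    obtain ⟨a, ha⟩ := h2 k
    rw [hk] at h1
    push_cast at h1
    exact h.ne a j (by omega)

theorem card_eq (h : μ.IsBoundary s s') :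
    μ.card = {p : ℤ × ℤ | p.1 ∈ Set.range s ∧ p.2 ∉ Set.range s ∧ p.2 < p.1}.ncard := by
  have : {p : ℤ × ℤ | p.1 ∈ Set.range s ∧ p.2 ∉ Set.range s ∧ p.2 < p.1} =
      (fun c : ℕ × ℕ => (s c.1, s' c.2)) '' (μ.cells : Set (ℕ × ℕ)) := by
    ext ⟨x, y⟩
    simp only [Set.mem_ofPred_eq, Set.mem_image, Prod.mk.injEq, Prod.exists]
    constructor
    · rintro ⟨⟨i, rfl⟩, hy, hlt⟩
      obtain ⟨j, rfl⟩ := h.exists_eq_of_notMem hy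
      exact ⟨i, j, (h.mem_iff i j).2 hlt, rfl, rfl⟩
    · rintro ⟨i, j, hij, rfl, rfl⟩
      exact ⟨⟨i, rfl⟩, fun ⟨k, hk⟩ => h.ne k j hk, (h.mem_iff i j).1 hij⟩
  rw [this, Set.ncard_image_of_injective, Set.ncard_coe_finset]
  rintro ⟨a, b⟩ ⟨c, d⟩ hab
  simp only [Prod.mk.injEq] at hab
  exact Prod.ext (h.anti.injective hab.1) (h.mono.injective hab.2)

end IsBoundary

end YoungDiagram

/-! ### Counting inversions by residue classes -/

theorem ncard_pairs_between (a b : ℤ) :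
    {p : ℤ × ℤ | b ≤ p.2 ∧ p.2 < p.1 ∧ p.1 < a}.ncard = (a - b).toNat.choose 2 := by
  have key : {p : ℤ × ℤ | b ≤ p.2 ∧ p.2 < p.1 ∧ p.1 < a} =
      (fun q : (_ : ℕ) × ℕ => ((q.1 : ℤ) + b, (q.2 : ℤ) + b)) ''
        ((Finset.range (a - b).toNat).sigma fun i => Finset.range i : Finset _) := by
    ext ⟨x, y⟩
    simp only [Set.mem_ofPred_eq, Set.mem_image, Finset.mem_coe, Finset.mem_sigma,
      Finset.mem_range, Prod.mk.injEq, Sigma.exists]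
    constructor
    · rintro ⟨h1, h2, h3⟩
      exact ⟨(x - b).toNat, (y - b).toNat, by omega, by omega, by omega⟩
    · rintro ⟨i, j, h1, h2, h3⟩
      omega
  rw [key, Set.ncard_image_of_injective, Set.ncard_coe_finset, Finset.card_sigma]
  · simp [Finset.sum_range_id, Nat.choose_two_right]
  · rintro ⟨i, j⟩ ⟨i', j'⟩ h
    simp only [Prod.mk.injEq] at h
    have h1 : i = i' := by omega
    have h2 : j = j' := by omega
    rw [h1, h2]

/-- The inversions of a set of integers whose members congruent to `r` modulo `t` are those `x`
with `x / t < n r`. -/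
theorem ncard_inversions {t : ℕ} (ht : 0 < t) (n : ℕ → ℤ) {S : Set ℤ}
    (hS : ∀ r < t, ∀ j : ℤ, (r : ℤ) + t * j ∈ S ↔ j < n r) :
    {p : ℤ × ℤ | p.1 ∈ S ∧ p.2 ∉ S ∧ p.2 < p.1}.ncard =
      ∑ r ∈ Finset.range t, ∑ q ∈ Finset.range t,
        (n r + (if q < r then 1 else 0) - n q).toNat.choose 2 := by
  have ht' : (0 : ℤ) < t := by exact_mod_cast ht
  have hfin : ∀ a b : ℤ, {p : ℤ × ℤ | b ≤ p.2 ∧ p.2 < p.1 ∧ p.1 < a}.Finite := by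
    intro a b
    refine ((Set.finite_Ioo b a).prod (Set.finite_Ico b a) |>.subset ?_)
    rintro ⟨x, y⟩ ⟨h1, h2, h3⟩
    simp only at h1 h2 h3
    simp only [Set.mem_prod, Set.mem_Ioo, Set.mem_Ico]
    omega
  -- Comparing `q + t * k` with `r + t * j` amounts to `k < j + ε`, where `ε` breaks ties by
  -- residue. Shifting `j` by `ε` turns the inversions of each residue pair into a triangle of
  -- integer pairs.
  let ε : ℕ × ℕ → ℤ := fun c => if c.2 < c.1 then 1 else 0
  let A : Finset ((_ : ℕ × ℕ) × (ℤ × ℤ)) :=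
    (Finset.range t ×ˢ Finset.range t).sigma fun c => (hfin (n c.1 + ε c) (n c.2)).toFinset
  let f : ((_ : ℕ × ℕ) × (ℤ × ℤ)) → ℤ × ℤ := fun z =>
    (z.1.1 + t * (z.2.1 - ε z.1), z.1.2 + t * z.2.2)
  have hmemA : ∀ r q : ℕ, ∀ j k : ℤ, (⟨(r, q), (j, k)⟩ : (_ : ℕ × ℕ) × (ℤ × ℤ)) ∈ A ↔
      (r < t ∧ q < t) ∧ n q ≤ k ∧ k < j ∧ j < n r + ε (r, q) := by
    intro r q j k
    simp [A]
  have hdiv : ∀ {r : ℕ} (_ : r < t) (j : ℤ),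
      ((r : ℤ) + t * j) % t = r ∧ ((r : ℤ) + t * j) / t = j := by
    intro r hr j
    constructor
    · rw [Int.add_mul_emod_self_left, Int.emod_eq_of_lt (by omega) (by omega)]
    · rw [Int.add_mul_ediv_left _ _ ht'.ne', Int.ediv_eq_zero_of_lt (by omega) (by omega)]
      simp
  have hlt : ∀ {r q : ℕ} (_ : r < t) (_ : q < t) (j k : ℤ),
      (q : ℤ) + t * k < r + t * j ↔ k < j + ε (r, q) := by
    intro r q hr hq j k
    simp only [ε]
    split_ifs with h
    · constructor
      · intro h1
        by_contra h2
        nlinarith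
      · intro h1
        nlinarith
    · constructor
      · intro h1
        by_contra h2
        nlinarith
      · intro h1
        nlinarith
  have key : {p : ℤ × ℤ | p.1 ∈ S ∧ p.2 ∉ S ∧ p.2 < p.1} = f '' (A : Set _) := by
    ext ⟨x, y⟩
    simp only [Set.mem_ofPred_eq, Set.mem_image, Finset.mem_coe]
    constructor
    · have hdec : ∀ x : ℤ, ∃ r : ℕ, r < t ∧ ∃ j : ℤ, x = r + t * j := fun x =>
        ⟨(x % t).toNat, by have := Int.emod_lt_of_pos x ht'; omega, x / t, by
          have h1 := Int.emod_nonneg x ht'.ne'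
          have h2 := Int.emod_add_mul_ediv x t
          omega⟩
      obtain ⟨r, hr, j, rfl⟩ := hdec x
      obtain ⟨q, hq, k, rfl⟩ := hdec y
      rintro ⟨h1, h2, h3⟩
      rw [hS r hr] at h1
      rw [hS q hq] at h2
      rw [hlt hr hq] at h3
      refine ⟨⟨(r, q), (j + ε (r, q), k)⟩, (hmemA _ _ _ _).2 ⟨⟨hr, hq⟩, by omega⟩, ?_⟩
      simp [f]
    · rintro ⟨⟨⟨r, q⟩, ⟨j, k⟩⟩, hz, hf⟩
      obtain ⟨⟨hr, hq⟩, h1, h2, h3⟩ := (hmemA _ _ _ _).1 hz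
      simp only [f, Prod.mk.injEq] at hf
      obtain ⟨rfl, rfl⟩ := hf
      rw [hS r hr, hS q hq, hlt hr hq]
      omega
  have hinj : Set.InjOn f (A : Set _) := by
    rintro ⟨⟨r, q⟩, ⟨j, k⟩⟩ hz ⟨⟨r', q'⟩, ⟨j', k'⟩⟩ hz' he
    obtain ⟨⟨hr, hq⟩, -⟩ := (hmemA _ _ _ _).1 (Finset.mem_coe.1 hz)
    obtain ⟨⟨hr', hq'⟩, -⟩ := (hmemA _ _ _ _).1 (Finset.mem_coe.1 hz')
    simp only [f, Prod.mk.injEq] at he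
    obtain ⟨h1, h2⟩ := he
    have a1 := hdiv hr (j - ε (r, q))
    have a2 := hdiv hq k
    rw [h1, (hdiv hr' _).1, (hdiv hr' _).2] at a1
    rw [h2, (hdiv hq' _).1, (hdiv hq' _).2] at a2
    obtain ⟨b1, b2⟩ := a1
    obtain ⟨b3, b4⟩ := a2
    have b1' : r' = r := by exact_mod_cast b1
    have b3' : q' = q := by exact_mod_cast b3
    subst b1' b3' b4
    have : j = j' := by omega
    rw [this]
  rw [key, hinj.ncard_image, Set.ncard_coe_finset, Finset.card_sigma,
    Finset.sum_product]
  refine Finset.sum_congr rfl fun r _ => Finset.sum_congr rfl fun q _ => ?_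
  rw [← Set.ncard_eq_toFinset_card _ (hfin _ _), ncard_pairs_between]

/-- At most one of the two truncations is nonzero, and `d * (d - 1)` is invariant under `d ↦ 1 - d`.
This merges the contributions of `(r, q)` and `(q, r)` into a polynomial. -/
theorem two_mul_choose_add_choose (d : ℤ) :
    2 * ((d.toNat.choose 2 : ℤ) + ((1 - d).toNat.choose 2 : ℤ)) = d * (d - 1) := by
  have h : ∀ m : ℕ, 2 * (m.choose 2 : ℤ) = m * (m - 1) := by
    intro m
    induction m with
    | zero => simp
    | succ m ih =>
      rw [Nat.choose_succ_succ' m 1, Nat.choose_one_right]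
      push_cast
      linarith
  rcases le_or_gt d 0 with hd | hd
  · have h1 : d.toNat = 0 := by omega
    have h2 : ((1 - d).toNat : ℤ) = 1 - d := by omega
    have := h (1 - d).toNat
    rw [h2] at this
    rw [h1, mul_add, this]
    simp
    ring
  · have h1 : (1 - d).toNat = 0 := by omega
    have h2 : (d.toNat : ℤ) = d := by omega
    have := h d.toNat
    rw [h2] at this
    rw [h1, mul_add, this]
    simp

theorem Int.exists_forall_iff_lt {P : ℤ → Prop} (hP : ∀ j, P j → P (j - 1)) {b : ℤ}
    (hb : ∀ j, P j → j ≤ b) (hne : ∃ j, P j) : ∃ n, ∀ j, P j ↔ j < n := by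
  obtain ⟨m, hm, hmax⟩ := Int.exists_greatest_of_bdd ⟨b, hb⟩ hne
  refine ⟨m + 1, fun j => ⟨fun hj => by have := hmax j hj; omega, fun hj => ?_⟩⟩
  have h : ∀ k : ℕ, P (m - k) := by
    intro k
    induction k with
    | zero => simpa using hm
    | succ k ih =>
      have := hP _ ih
      rwa [sub_sub] at this
  have := h (m - j).toNat
  rwa [show m - ((m - j).toNat : ℤ) = j by omega] at this

theorem Int.exists_strictMono_range_eq {A : Set ℤ} {m : ℤ} (hm : ∀ x ∈ A, m ≤ x)
    (hA : ∀ x, ∃ y ∈ A, x < y) : ∃ s : ℕ → ℤ, StrictMono s ∧ Set.range s = A := by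
  have hinf : {k : ℕ | (k : ℤ) + m ∈ A}.Infinite := by
    rw [Set.infinite_iff_exists_gt]
    intro a
    obtain ⟨y, hy, hlt⟩ := hA (a + m)
    refine ⟨(y - m).toNat, ?_, ?_⟩
    · rw [Set.mem_ofPred_eq]
      rwa [show ((y - m).toNat : ℤ) + m = y by omega]
    · omega
  refine ⟨fun j => (Nat.nth (fun k : ℕ => (k : ℤ) + m ∈ A) j : ℤ) + m, ?_, ?_⟩
  · intro a b hab
    have := Nat.nth_strictMono hinf hab
    simp only
    omega
  · ext x
    constructor
    · rintro ⟨j, rfl⟩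
      exact Nat.nth_mem_of_infinite hinf j
    · intro hx
      have h1 : (x - m).toNat ∈ Set.range (Nat.nth fun k : ℕ => (k : ℤ) + m ∈ A) := by
        rw [Nat.range_nth_of_infinite hinf, Set.mem_ofPred_eq]
        have := hm x hx
        rwa [show ((x - m).toNat : ℤ) + m = x by omega]
      obtain ⟨j, hj⟩ := h1
      refine ⟨j, ?_⟩
      have := hm x hx
      simp only [hj]
      omega

/-! ### Cores and their charges -/

namespace YoungDiagram

theorem IsBoundary.exists_charge {μ : YoungDiagram} {s s' : ℕ → ℤ} (h : μ.IsBoundary s s')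
    {t : ℕ} (ht : 0 < t) (hμ : μ.IsCore t) :
    ∃ n : ℕ → ℤ, ∀ r : ℕ, ∀ j : ℤ, (r : ℤ) + t * j ∈ Set.range s ↔ j < n r := by
  rw [h.isCore_iff ht] at hμ
  have ht' : (0 : ℤ) < t := by exact_mod_cast ht
  suffices ∀ r : ℕ, ∃ n : ℤ, ∀ j : ℤ, (r : ℤ) + t * j ∈ Set.range s ↔ j < n by
    choose n hn using this
    exact ⟨n, hn⟩
  intro r
  refine Int.exists_forall_iff_lt (b := |s 0|) ?_ ?_ ?_
  · intro j hj
    have := hμ _ hj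
    rwa [show (r : ℤ) + t * (j - 1) = r + t * j - t by ring]
  · rintro j ⟨i, hi⟩
    have h1 := h.anti.antitone (Nat.zero_le i)
    have h2 := le_abs_self (s 0)
    by_contra hj
    have h3 := abs_nonneg (s 0)
    nlinarith
  -- Far enough down that `r + t * j < s' 0`; every integer below the first horizontal step is
  -- vertical.
  · refine ⟨-(|s' 0| + r + 1), ?_⟩
    by_contra hx
    obtain ⟨k, hk⟩ := h.exists_eq_of_notMem hx
    have h1 := h.mono.monotone (Nat.zero_le k)
    have h2 := neg_abs_le (s' 0)
    have h3 := abs_nonneg (s' 0)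
    nlinarith

theorem IsBoundary.card_eq_sum {μ : YoungDiagram} {s s' : ℕ → ℤ} (h : μ.IsBoundary s s')
    {t : ℕ} (ht : 0 < t) (n : ℕ → ℤ)
    (hn : ∀ r < t, ∀ j : ℤ, (r : ℤ) + t * j ∈ Set.range s ↔ j < n r) :
    (μ.card : ℤ) = ∑ r ∈ Finset.range t, ∑ q ∈ Finset.range t,
        ((n r + (if q < r then 1 else 0) - n q).toNat.choose 2 : ℤ) := by
  rw [h.card_eq, ncard_inversions ht n hn]
  push_cast
  rfl

theorem IsBoundary.isCore_of_charge {μ : YoungDiagram} {s s' : ℕ → ℤ} (h : μ.IsBoundary s s')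
    {t : ℕ} (ht : 0 < t) (n : ℕ → ℤ)
    (hn : ∀ r < t, ∀ j : ℤ, (r : ℤ) + t * j ∈ Set.range s ↔ j < n r) : μ.IsCore t := by
  rw [h.isCore_iff ht]
  have ht' : (0 : ℤ) < t := by exact_mod_cast ht
  intro x hx
  have h1 := Int.emod_nonneg x ht'.ne'
  have h2 := Int.emod_lt_of_pos x ht'
  have h3 : x = ((x % t).toNat : ℤ) + t * (x / t) := by
    have := Int.emod_add_mul_ediv x t
    omega
  rw [h3, hn _ (by omega)] at hx
  rw [h3, show ((x % t).toNat : ℤ) + t * (x / t) - t = (x % t).toNat + t * (x / t - 1) by ring,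
    hn _ (by omega)]
  omega

/-- The set of integers `x` with `x / t < n r`, where `r` is the residue of `x` modulo `t`. -/
def chargeSet (t : ℕ) (n : ℕ → ℤ) : Set ℤ := {x | x / t < n (x % t).toNat}

theorem add_mul_mem_chargeSet {t : ℕ} (n : ℕ → ℤ) {r : ℕ} (hr : r < t) (j : ℤ) :
    (r : ℤ) + t * j ∈ chargeSet t n ↔ j < n r := by
  have ht' : (0 : ℤ) < t := by omega
  unfold chargeSet
  rw [Set.mem_ofPred_eq, Int.add_mul_emod_self_left, Int.emod_eq_of_lt (by omega) (by omega),
    Int.add_mul_ediv_left _ _ ht'.ne', Int.ediv_eq_zero_of_lt (by omega) (by omega)]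
  simp

theorem chargeSet_bounds {t : ℕ} (ht : 0 < t) (n : ℕ → ℤ) :
    ∃ m : ℤ, (∀ x ∉ chargeSet t n, -m ≤ x) ∧ ∀ x ∈ chargeSet t n, x ≤ m := by
  have ht' : (0 : ℤ) < t := by exact_mod_cast ht
  refine ⟨t * ∑ r ∈ Finset.range t, |n r|, ?_⟩
  have hb : ∀ x : ℤ, |n (x % t).toNat| ≤ ∑ r ∈ Finset.range t, |n r| := by
    intro x
    refine Finset.single_le_sum (f := fun r => |n r|) (fun r _ => abs_nonneg _) ?_
    have h1 := Int.emod_nonneg x ht'.ne'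
    have h2 := Int.emod_lt_of_pos x ht'
    rw [Finset.mem_range]
    omega
  have hx : ∀ x : ℤ, x % t + t * (x / t) = x := fun x => Int.emod_add_mul_ediv x t
  constructor
  · intro x h
    have h3 : ¬ x / t < n (x % t).toNat := h
    have h4 := neg_abs_le (n (x % t).toNat)
    have h5 := hb x
    have h1 := Int.emod_nonneg x ht'.ne'
    have h6 := hx x
    have : -(∑ r ∈ Finset.range t, |n r|) ≤ x / t := by omega
    nlinarith
  · intro x h
    have h3 : x / t < n (x % t).toNat := h
    have h4 := le_abs_self (n (x % t).toNat)
    have h5 := hb x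
    have h2 := Int.emod_lt_of_pos x ht'
    have h6 := hx x
    have : x / t + 1 ≤ (∑ r ∈ Finset.range t, |n r|) := by omega
    nlinarith

theorem exists_enum_compl_chargeSet {t : ℕ} (ht : 0 < t) (n : ℕ → ℤ) :
    ∃ s : ℕ → ℤ, StrictMono s ∧ Set.range s = (chargeSet t n)ᶜ := by
  obtain ⟨m, h1, h2⟩ := chargeSet_bounds ht n
  refine Int.exists_strictMono_range_eq h1 fun x => ⟨max x m + 1, fun h => ?_, ?_⟩
  · have := h2 _ h
    omega
  · omega

theorem exists_enum_chargeSet {t : ℕ} (ht : 0 < t) (n : ℕ → ℤ) :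
    ∃ s : ℕ → ℤ, StrictAnti s ∧ Set.range s = chargeSet t n := by
  obtain ⟨m, h1, h2⟩ := chargeSet_bounds ht n
  obtain ⟨s, hs, hr⟩ := Int.exists_strictMono_range_eq (A := {x | -x ∈ chargeSet t n}) (m := -m)
    (fun x hx => by have := h2 _ hx; omega)
    fun x => ⟨max x m + 1, by
      rw [Set.mem_ofPred_eq]
      by_contra h
      have := h1 _ h
      omega, by omega⟩
  refine ⟨fun i => -s i, fun a b hab => neg_lt_neg (hs hab), ?_⟩
  ext x
  have : -x ∈ Set.range s ↔ x ∈ chargeSet t n := by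
    rw [hr, Set.mem_ofPred_eq, neg_neg]
  rw [← this]
  simp only [Set.mem_range, neg_eq_iff_eq_neg]

/-- The charges need not sum to zero: `IsBoundary` fixes the path only up to translation. -/
theorem exists_core_of_charge {t : ℕ} (ht : 0 < t) (n : ℕ → ℤ) :
    ∃ μ : YoungDiagram, μ.IsCore t ∧ (μ.card : ℤ) = ∑ r ∈ Finset.range t, ∑ q ∈ Finset.range t,
        ((n r + (if q < r then 1 else 0) - n q).toNat.choose 2 : ℤ) := by
  obtain ⟨s, hs, hr⟩ := exists_enum_chargeSet ht n
  obtain ⟨s', hs', hr'⟩ := exists_enum_compl_chargeSet ht n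
  obtain ⟨μ, h⟩ := exists_isBoundary hs hs' (by rw [hr, hr'])
  have hn : ∀ r < t, ∀ j : ℤ, (r : ℤ) + t * j ∈ Set.range s ↔ j < n r := fun r hrt j => by
    rw [hr, add_mul_mem_chargeSet n hrt]
  exact ⟨μ, h.isCore_of_charge ht n hn, h.card_eq_sum ht n hn⟩

/-- The symmetry of `n` makes `x ↦ -1 - x` exchange the charge set and its complement. With `s i =
-1 - s' i`, the cell condition reads `s' i + s' j < -1`, which is symmetric in `i` and `j`. -/
theorem exists_selfConj_core_of_charge {t : ℕ} (ht : 0 < t) (n : ℕ → ℤ)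
    (hsym : ∀ r < t, n (t - 1 - r) = -n r) :
    ∃ μ : YoungDiagram, μ.IsCore t ∧ μ.transpose = μ ∧
      (μ.card : ℤ) = ∑ r ∈ Finset.range t, ∑ q ∈ Finset.range t,
        ((n r + (if q < r then 1 else 0) - n q).toNat.choose 2 : ℤ) := by
  have ht' : (0 : ℤ) < t := by exact_mod_cast ht
  obtain ⟨s', hs', hr'⟩ := exists_enum_compl_chargeSet ht n
  have hsymm : ∀ x, -1 - x ∉ chargeSet t n ↔ x ∈ chargeSet t n := by
    intro x
    have h1 := Int.emod_nonneg x ht'.ne'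
    have h2 := Int.emod_lt_of_pos x ht'
    have h3 := Int.emod_add_mul_ediv x t
    obtain ⟨r, hr⟩ : ∃ r : ℕ, (r : ℤ) = x % t := ⟨(x % t).toNat, by omega⟩
    rw [← hr] at h1 h2 h3
    have hrt : r < t := by omega
    have h4 : -1 - x = ((t - 1 - r : ℕ) : ℤ) + t * (-1 - x / t) := by
      rw [Nat.cast_sub (by omega), Nat.cast_sub (by omega)]
      push_cast
      linear_combination h3
    rw [h4, add_mul_mem_chargeSet n (by omega), hsym r hrt]
    nth_rewrite 2 [← h3]
    rw [add_mul_mem_chargeSet n hrt]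
    omega
  have hr : Set.range (fun i => -1 - s' i) = chargeSet t n := by
    ext x
    rw [← hsymm, ← Set.mem_compl_iff, ← hr']
    simp only [Set.mem_range]
    exact exists_congr fun i => ⟨fun h => by omega, fun h => by omega⟩
  obtain ⟨μ, h⟩ := exists_isBoundary (s := fun i => -1 - s' i) (s' := s')
    (fun a b hab => by have := hs' hab; simp only; omega) hs' (by rw [hr, hr'])
  have hn : ∀ r < t, ∀ j : ℤ, (r : ℤ) + t * j ∈ Set.range (fun i => -1 - s' i) ↔ j < n r :=
    fun r hrt j => by rw [hr, add_mul_mem_chargeSet n hrt]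
  refine ⟨μ, h.isCore_of_charge ht n hn, ?_, h.card_eq_sum ht n hn⟩
  ext ⟨i, j⟩
  rw [mem_cells, mem_cells, mem_transpose, Prod.swap_prod_mk, h.mem_iff, h.mem_iff]
  omega

/-- Here the position of the path matters: for `s i = λ_i - i - 1`, conjugation is the reflection `x
↦ -1 - x`, which sends residue `r` and quotient `j` to `t - 1 - r` and `-1 - j`. -/
theorem exists_charge_neg_of_transpose_eq {μ : YoungDiagram} {t : ℕ} (ht : 0 < t)
    (hμ : μ.IsCore t) (hT : μ.transpose = μ) :
    ∃ n : ℕ → ℤ, (∀ r < t, n (t - 1 - r) = -n r) ∧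
      (μ.card : ℤ) = ∑ r ∈ Finset.range t, ∑ q ∈ Finset.range t,
        ((n r + (if q < r then 1 else 0) - n q).toNat.choose 2 : ℤ) := by
  have h := μ.isBoundary_rowLen_colLen
  obtain ⟨n, hn⟩ := h.exists_charge ht hμ
  refine ⟨n, ?_, h.card_eq_sum ht n fun r _ => hn r⟩
  have hcol : ∀ j, μ.colLen j = μ.rowLen j := fun j => by
    rw [← rowLen_transpose, hT]
  have hsymm : ∀ x : ℤ, -1 - x ∈ Set.range (fun i : ℕ => (μ.rowLen i : ℤ) - i - 1) ↔
      x ∉ Set.range (fun i : ℕ => (μ.rowLen i : ℤ) - i - 1) := by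
    intro x
    rw [← Set.mem_compl_iff, ← h.compl]
    simp only [Set.mem_range, hcol]
    exact exists_congr fun i => ⟨fun h => by omega, fun h => by omega⟩
  intro r hr
  have key : ∀ j : ℤ, -1 - j < n (t - 1 - r) ↔ ¬ j < n r := by
    intro j
    rw [← hn r j, ← hn (t - 1 - r), ← hsymm]
    have h4 : -1 - ((r : ℤ) + t * j) = ((t - 1 - r : ℕ) : ℤ) + t * (-1 - j) := by
      rw [Nat.cast_sub (by omega), Nat.cast_sub (by omega)]
      push_cast
      ring
    rw [h4]
  have h1 := key (n r)
  have h2 := key (n r - 1)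
  omega

end YoungDiagram

/-! ### Non-vanishing as representation by quadratic forms -/

theorem coreCount_ne_zero_iff (t n : ℕ) :
    coreCount t n ≠ 0 ↔ ∃ μ : YoungDiagram, μ.card = n ∧ μ.IsCore t := by
  unfold coreCount
  rw [Ne, Set.ncard_eq_zero ((YoungDiagram.finite_card_eq n).subset fun μ h => h.1), ← Ne,
    ← Set.nonempty_iff_ne_empty]
  rfl

theorem selfConjCoreCount_ne_zero_iff (t n : ℕ) :
    selfConjCoreCount t n ≠ 0 ↔
      ∃ μ : YoungDiagram, μ.card = n ∧ μ.IsCore t ∧ μ.transpose = μ := by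
  unfold selfConjCoreCount
  rw [Ne, Set.ncard_eq_zero ((YoungDiagram.finite_card_eq n).subset fun μ h => h.1), ← Ne,
    ← Set.nonempty_iff_ne_empty]
  rfl

theorem two_mul_sum_choose_three (n : ℕ → ℤ) :
    2 * ∑ r ∈ Finset.range 3, ∑ q ∈ Finset.range 3,
        ((n r + (if q < r then 1 else 0) - n q).toNat.choose 2 : ℤ) =
      (n 0 - n 1) * (n 0 - n 1 - 1) + (n 0 - n 2) * (n 0 - n 2 - 1) +
        (n 1 - n 2) * (n 1 - n 2 - 1) := by
  have h : ∀ a b : ℤ, 2 * (((b + 1 - a).toNat.choose 2 : ℤ)) =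
      (a - b) * (a - b - 1) - 2 * ((a - b).toNat.choose 2 : ℤ) := by
    intro a b
    have := two_mul_choose_add_choose (a - b)
    rw [show 1 - (a - b) = b + 1 - a by ring] at this
    linear_combination this
  simp only [Finset.sum_range_succ, Finset.sum_range_zero, mul_add, mul_zero]
  norm_num [h]
  ring

theorem two_mul_sum_choose_five {n : ℕ → ℤ} (hn : ∀ r < 5, n (5 - 1 - r) = -n r) :
    ∑ r ∈ Finset.range 5, ∑ q ∈ Finset.range 5,
        ((n r + (if q < r then 1 else 0) - n q).toNat.choose 2 : ℤ) =
      5 * n 0 ^ 2 + 5 * n 1 ^ 2 - 4 * n 0 - 2 * n 1 := by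
  have h : ∀ a b : ℤ, 2 * (((b + 1 - a).toNat.choose 2 : ℤ)) =
      (a - b) * (a - b - 1) - 2 * ((a - b).toNat.choose 2 : ℤ) := by
    intro a b
    have := two_mul_choose_add_choose (a - b)
    rw [show 1 - (a - b) = b + 1 - a by ring] at this
    linear_combination this
  have h0 : n 4 = -n 0 := hn 0 (by norm_num)
  have h1 : n 3 = -n 1 := hn 1 (by norm_num)
  have h2 : n 2 = 0 := by
    have : n 2 = -n 2 := hn 2 (by norm_num)
    omega
  refine mul_left_cancel₀ (two_ne_zero (α := ℤ)) ?_
  simp only [Finset.sum_range_succ, Finset.sum_range_zero, mul_add, mul_zero]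
  norm_num only [h, add_zero, zero_add, if_true, if_false, sub_self, Int.toNat_zero,
    Nat.choose, Nat.cast_zero]
  rw [h0, h1, h2]
  ring

theorem coreCount_three_ne_zero_iff (n : ℕ) :
    coreCount 3 n ≠ 0 ↔ ∃ x y : ℤ, x ^ 2 + x * y + y ^ 2 = 3 * n + 1 := by
  rw [coreCount_ne_zero_iff]
  constructor
  · rintro ⟨μ, rfl, hμ⟩
    have h := μ.isBoundary_rowLen_colLen
    obtain ⟨c, hc⟩ := h.exists_charge (by norm_num) hμ
    have h1 := h.card_eq_sum (by norm_num) c fun r _ => hc r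
    have h2 := two_mul_sum_choose_three c
    rw [← h1] at h2
    -- With `d = c 1 - c 2`, these are `x = c 0 - c 1 - d` and `y = x + 3 * d - 1`; the converse
    -- inverts this substitution, normalised by `c 1 = 0`.
    refine ⟨c 0 - 2 * c 1 + c 2, c 0 + c 1 - 2 * c 2 - 1, ?_⟩
    refine mul_left_cancel₀ (two_ne_zero (α := ℤ)) ?_
    linear_combination -3 * h2
  · rintro ⟨x, y, hxy⟩
    -- If 3 divided `y - x` it would divide the form, whose value is 1 modulo 3. So `y - x` is `±1`
    -- modulo 3, and negating both variables selects the class `-1`.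
    obtain ⟨x, y, hxy, d, hd⟩ : ∃ x y : ℤ, x ^ 2 + x * y + y ^ 2 = 3 * n + 1 ∧
        ∃ d, y = x + 3 * d - 1 := by
      have h3 : (y - x) % 3 = 1 ∨ (y - x) % 3 = 2 := by
        by_contra h
        have h0 : y - x = 3 * ((y - x) / 3) := by omega
        generalize (y - x) / 3 = d at h0
        obtain rfl : y = x + 3 * d := by omega
        have : 3 * (x ^ 2 + 3 * x * d + 3 * d ^ 2 - n) = 1 := by linear_combination hxy
        omega
      rcases h3 with h3 | h3
      · exact ⟨-x, -y, by linear_combination hxy, (-y + x + 1) / 3, by omega⟩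
      · exact ⟨x, y, hxy, (y - x + 1) / 3, by omega⟩
    subst hd
    obtain ⟨μ, hμ, hcard⟩ := YoungDiagram.exists_core_of_charge (t := 3) (by norm_num)
      fun r => if r = 0 then x + d else if r = 1 then 0 else -d
    have h2 := two_mul_sum_choose_three fun r => if r = 0 then x + d else if r = 1 then 0 else -d
    rw [← hcard] at h2
    refine ⟨μ, ?_, hμ⟩
    norm_num at h2
    have : (6 * μ.card : ℤ) = 6 * n := by linear_combination 3 * h2 + 2 * hxy
    omega

theorem selfConjCoreCount_five_ne_zero_iff (n : ℕ) :
    selfConjCoreCount 5 n ≠ 0 ↔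
      ∃ a b : ℤ, (5 * a - 2) ^ 2 + (5 * b - 1) ^ 2 = 5 * (n + 1) := by
  rw [selfConjCoreCount_ne_zero_iff]
  constructor
  · rintro ⟨μ, rfl, hμ, hT⟩
    obtain ⟨c, hc, hcard⟩ :=
      YoungDiagram.exists_charge_neg_of_transpose_eq (by norm_num) hμ hT
    rw [two_mul_sum_choose_five hc] at hcard
    exact ⟨c 0, c 1, by linear_combination -5 * hcard⟩
  · rintro ⟨a, b, h⟩
    have hs : ∀ r < 5, (![a, b, 0, -b, -a] : Fin 5 → ℤ) (Fin.ofNat 5 (5 - 1 - r)) =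
        -(![a, b, 0, -b, -a] : Fin 5 → ℤ) (Fin.ofNat 5 r) := by
      intro r hr
      interval_cases r <;> simp [Fin.ofNat]
    obtain ⟨μ, hμ, hT, hcard⟩ := YoungDiagram.exists_selfConj_core_of_charge (t := 5)
      (by norm_num) (fun r => (![a, b, 0, -b, -a] : Fin 5 → ℤ) (Fin.ofNat 5 r)) hs
    rw [two_mul_sum_choose_five hs] at hcard
    refine ⟨μ, ?_, hμ, hT⟩
    simp [Fin.ofNat] at hcard
    have : (5 * μ.card : ℤ) = 5 * n := by
      rw [hcard]
      linear_combination h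
    omega

/-! ### Primes and the two norm forms -/

theorem eisenstein_norm_mul {a b x y : ℤ} :
    (a ^ 2 + a * b + b ^ 2) * (x ^ 2 + x * y + y ^ 2) =
      (a * x - b * y) ^ 2 + (a * x - b * y) * (a * y + b * x + b * y) +
        (a * y + b * x + b * y) ^ 2 := by
  ring

/-- Otherwise `x / y` modulo `p` would be an element of order 3 in a group of order `p - 1`, which 3
does not divide. -/
theorem Nat.Prime.dvd_of_dvd_eisenstein_norm {p : ℕ} (hp : p.Prime) (h3 : p % 3 = 2) {x y : ℤ}
    (h : (p : ℤ) ∣ x ^ 2 + x * y + y ^ 2) : (p : ℤ) ∣ x ∧ (p : ℤ) ∣ y := by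
  have : Fact p.Prime := ⟨hp⟩
  rw [← ZMod.intCast_zmod_eq_zero_iff_dvd] at h
  rw [← ZMod.intCast_zmod_eq_zero_iff_dvd, ← ZMod.intCast_zmod_eq_zero_iff_dvd]
  push_cast at h
  generalize (x : ZMod p) = u at *
  generalize (y : ZMod p) = v at *
  by_cases hv : v = 0
  · subst hv
    simpa using h
  exfalso
  have hz : (u / v) ^ 2 + u / v + 1 = 0 := by
    field_simp
    linear_combination h
  generalize u / v = z at hz
  have hz3 : z ^ 3 = 1 := by linear_combination (z - 1) * hz
  have hz1 : z ≠ 1 := by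
    rintro rfl
    have h0 : ((3 : ℕ) : ZMod p) = 0 := by
      push_cast
      linear_combination hz
    rw [ZMod.natCast_eq_zero_iff] at h0
    have := (Nat.prime_dvd_prime_iff_eq hp Nat.prime_three).1 h0
    omega
  have : Fact (Nat.Prime 3) := ⟨Nat.prime_three⟩
  have ho : orderOf z = 3 := orderOf_eq_prime hz3 hz1
  have hz0 : z ≠ 0 := by
    rintro rfl
    simp at hz3
  have h1 : orderOf z ∣ p - 1 := orderOf_dvd_of_pow_eq_one (ZMod.pow_card_sub_one_eq_one hz0)
  rw [ho] at h1
  have := hp.two_le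
  omega

/-- An inert prime divides both coordinates, so it enters a norm at least squared. This lemma and
its Gaussian analogue are used in contrapositive form, to exclude representations. -/
theorem not_sq_dvd_of_eq_eisenstein_norm {p L : ℕ} (hp : p.Prime) (h3 : p % 3 = 2)
    (hL : p ∣ L) {x y : ℤ} (h : x ^ 2 + x * y + y ^ 2 = L) : p ^ 2 ∣ L := by
  have h1 : (p : ℤ) ∣ x ^ 2 + x * y + y ^ 2 := by
    rw [h]
    exact_mod_cast hL
  obtain ⟨⟨a, rfl⟩, b, rfl⟩ := hp.dvd_of_dvd_eisenstein_norm h3 h1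
  have : ((p ^ 2 : ℕ) : ℤ) ∣ L := ⟨a ^ 2 + a * b + b ^ 2, by rw [← h]; push_cast; ring⟩
  exact_mod_cast this

theorem sq_dvd_of_eq_sq_add_sq {p L : ℕ} (hp : p.Prime) (h4 : p % 4 = 3)
    (hL : p ∣ L) {x y : ℤ} (h : x ^ 2 + y ^ 2 = L) : p ^ 2 ∣ L := by
  have : Fact p.Prime := ⟨hp⟩
  have h1 : ((x : ZMod p)) ^ 2 + (y : ZMod p) ^ 2 = 0 := by
    have : ((L : ℕ) : ZMod p) = 0 := (ZMod.natCast_eq_zero_iff _ _).2 hL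
    rw [← this]
    exact_mod_cast congrArg (Int.cast : ℤ → ZMod p) h
  have hy : (y : ZMod p) = 0 := by
    by_contra hy
    exact ZMod.mod_four_ne_three_of_sq_eq_neg_sq' hy (eq_neg_of_add_eq_zero_left h1) h4
  have hx : (x : ZMod p) = 0 := by
    rw [hy] at h1
    simpa using h1
  rw [ZMod.intCast_zmod_eq_zero_iff_dvd] at hx hy
  obtain ⟨a, rfl⟩ := hx
  obtain ⟨b, rfl⟩ := hy
  have : ((p ^ 2 : ℕ) : ℤ) ∣ L := ⟨a ^ 2 + b ^ 2, by rw [← h]; push_cast; ring⟩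
  exact_mod_cast this

theorem Nat.Prime.exists_sq_add_self_add_one_eq_zero {p : ℕ} [Fact p.Prime] (h3 : p % 3 = 1) :
    ∃ z : ZMod p, z ^ 2 + z + 1 = 0 := by
  have : Fact (Nat.Prime 3) := ⟨Nat.prime_three⟩
  have hd : 3 ∣ Fintype.card (ZMod p)ˣ := by
    rw [ZMod.card_units]
    omega
  obtain ⟨u, hu⟩ := exists_prime_orderOf_dvd_card 3 hd
  refine ⟨u, ?_⟩
  have h1 : (u : ZMod p) ^ 3 = 1 := by
    rw [← Units.val_pow_eq_pow_val, ← hu, pow_orderOf_eq_one, Units.val_one]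
  have h2 : (u : ZMod p) ≠ 1 := by
    intro h
    have : u = 1 := Units.ext h
    rw [this, orderOf_one] at hu
    omega
  have h4 : ((u : ZMod p) - 1) * ((u : ZMod p) ^ 2 + u + 1) = 0 := by linear_combination h1
  exact (_root_.mul_eq_zero.1 h4).resolve_left (sub_ne_zero.2 h2)

/-- Thue's argument: with `z` a root of `z² + z + 1` modulo `p`, the pigeonhole principle gives a
small nonzero `(x, y)` with `x ≡ z * y`, whose norm is a multiple of `p` below `3 * p`. The value `2
* p` is impossible, because an even norm is divisible by 4. -/
theorem Nat.Prime.eq_eisenstein_norm {p : ℕ} (hp : p.Prime) (h3 : p % 3 = 1) :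
    ∃ x y : ℤ, x ^ 2 + x * y + y ^ 2 = p := by
  have : Fact p.Prime := ⟨hp⟩
  obtain ⟨z, hz⟩ := Nat.Prime.exists_sq_add_self_add_one_eq_zero (p := p) h3
  have hcard : (Finset.univ : Finset (ZMod p)).card <
      (Finset.range (p.sqrt + 1) ×ˢ Finset.range (p.sqrt + 1)).card := by
    rw [Finset.card_univ, ZMod.card, Finset.card_product, Finset.card_range]
    exact Nat.lt_succ_sqrt p
  obtain ⟨⟨a, b⟩, hab, ⟨c, d⟩, hcd, hne, heq⟩ :=
    Finset.exists_ne_map_eq_of_card_lt_of_maps_to hcard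
      (f := fun q : ℕ × ℕ => (q.1 : ZMod p) - z * q.2) (fun _ _ => Finset.mem_coe.2 (Finset.mem_univ _))
  simp only [Finset.mem_product, Finset.mem_range] at hab hcd heq
  have hsq : (p.sqrt : ℤ) ^ 2 < p := by
    have h1 : p.sqrt ^ 2 ≤ p := Nat.sqrt_le' p
    have h2 : p.sqrt ^ 2 ≠ p := fun h => hp.not_isSquare ⟨p.sqrt, by rw [← sq]; exact h.symm⟩
    exact_mod_cast lt_of_le_of_ne h1 h2
  obtain ⟨x, hx⟩ : ∃ x : ℤ, x = a - c := ⟨_, rfl⟩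
  obtain ⟨y, hy⟩ : ∃ y : ℤ, y = b - d := ⟨_, rfl⟩
  have hx2 : x ^ 2 ≤ (p.sqrt : ℤ) ^ 2 := sq_le_sq' (by omega) (by omega)
  have hy2 : y ^ 2 ≤ (p.sqrt : ℤ) ^ 2 := sq_le_sq' (by omega) (by omega)
  have hxy0 : ¬ (x = 0 ∧ y = 0) := by
    rintro ⟨h1, h2⟩
    exact hne (Prod.ext (by simp only; omega) (by simp only; omega))
  have hdvd : (p : ℤ) ∣ x ^ 2 + x * y + y ^ 2 := by
    rw [← ZMod.intCast_zmod_eq_zero_iff_dvd, hx, hy]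
    push_cast
    have h1 : (a : ZMod p) - c = z * (b - d) := by linear_combination heq
    rw [h1]
    linear_combination (b - d : ZMod p) ^ 2 * hz
  have hpos : 0 < x ^ 2 + x * y + y ^ 2 := by
    by_contra hle
    have h1 : x ^ 2 = 0 := by nlinarith [sq_nonneg (x + y), sq_nonneg x, sq_nonneg y]
    have h2 : y ^ 2 = 0 := by nlinarith [sq_nonneg (x + y), sq_nonneg x, sq_nonneg y]
    exact hxy0 ⟨by simpa using h1, by simpa using h2⟩
  obtain ⟨m, hm⟩ := hdvd
  have hp0 : (0 : ℤ) < p := by exact_mod_cast hp.pos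
  have hm3 : m < 3 := by
    by_contra h
    nlinarith [sq_nonneg (x - y)]
  have hm0 : 0 < m := by
    by_contra h
    nlinarith
  obtain rfl | rfl : m = 1 ∨ m = 2 := by omega
  · exact ⟨x, y, by rw [hm, mul_one]⟩
  · exfalso
    have h2 : (p : ℤ) % 2 = 1 := by
      have h5 : p ≠ 2 := by
        rintro rfl
        omega
      have := hp.eq_two_or_odd
      omega
    have key : (x ^ 2 + x * y + y ^ 2) % 4 = 2 := by
      rw [hm]
      omega
    have hx4 : x % 4 = 0 ∨ x % 4 = 1 ∨ x % 4 = 2 ∨ x % 4 = 3 := by omega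
    have hy4 : y % 4 = 0 ∨ y % 4 = 1 ∨ y % 4 = 2 ∨ y % 4 = 3 := by omega
    rcases hx4 with h | h | h | h <;> rcases hy4 with h' | h' | h' | h' <;>
      simp [sq, Int.add_emod, Int.mul_emod, h, h'] at key

/-- Multiplying by a sum of two squares that is `1` modulo `5` keeps the residues of the two
squared integers in a representation. -/
theorem exists_rep_mul_sq_add_sq {N u a b x y : ℤ} (h : (5 * a - 2) ^ 2 + (5 * b - 1) ^ 2 = 5 * N)
    (hu : x ^ 2 + y ^ 2 = u) (hu5 : u % 5 = 1) :
    ∃ c d : ℤ, (5 * c - 2) ^ 2 + (5 * d - 1) ^ 2 = 5 * (N * u) := by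
  -- Modulo 5, one of the squares is 1 and the other 0. After a swap and signs, `x + y i ≡ 1` modulo
  -- 5, so Gaussian multiplication by it preserves both residues.
  obtain ⟨x, y, rfl, hx, hy⟩ : ∃ x y : ℤ, x ^ 2 + y ^ 2 = u ∧ x % 5 = 1 ∧ y % 5 = 0 := by
    have hx5 : x % 5 = 0 ∨ x % 5 = 1 ∨ x % 5 = 2 ∨ x % 5 = 3 ∨ x % 5 = 4 := by omega
    have hy5 : y % 5 = 0 ∨ y % 5 = 1 ∨ y % 5 = 2 ∨ y % 5 = 3 ∨ y % 5 = 4 := by omega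
    have key : (x ^ 2 + y ^ 2) % 5 = 1 := by rw [hu, hu5]
    have hcases : (x % 5 = 1 ∧ y % 5 = 0) ∨ (x % 5 = 4 ∧ y % 5 = 0) ∨ (x % 5 = 0 ∧ y % 5 = 1) ∨
        (x % 5 = 0 ∧ y % 5 = 4) := by
      rcases hx5 with h | h | h | h | h <;> rcases hy5 with h' | h' | h' | h' | h' <;>
        simp [sq, Int.add_emod, Int.mul_emod, h, h'] at key ⊢
    rcases hcases with ⟨h1, h2⟩ | ⟨h1, h2⟩ | ⟨h1, h2⟩ | ⟨h1, h2⟩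
    · exact ⟨x, y, hu, h1, h2⟩
    · exact ⟨-x, -y, by linear_combination hu, by omega, by omega⟩
    · exact ⟨y, x, by linear_combination hu, h2, h1⟩
    · exact ⟨-y, -x, by linear_combination hu, by omega, by omega⟩
  obtain ⟨X, rfl⟩ : ∃ X, x = 5 * X + 1 := ⟨x / 5, by omega⟩
  obtain ⟨Y, rfl⟩ : ∃ Y, y = 5 * Y := ⟨y / 5, by omega⟩
  refine ⟨(5 * a - 2) * X + a - (5 * b - 1) * Y, (5 * a - 2) * Y + (5 * b - 1) * X + b, ?_⟩
  linear_combination ((5 * X + 1) ^ 2 + (5 * Y) ^ 2) * h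

/-! ### Dirichlet's theorem on two linear forms at once -/

/-- Let `Q` be closed under multiplication and contain the primes congruent to `1` or `r` modulo
`12`. Then for infinitely many `n` the value `A * n + B` is the product of its value at `n₀` with a
member of `Q`, while `C * n + D` is exactly divisible by a prime congruent to `r` modulo `12`. -/
theorem exists_large_progression {Q : ℕ → Prop} (hmul : ∀ u v, Q u → Q v → Q (u * v)) {r : ℕ}
    (hr : r = 5 ∨ r = 7) (hQ : ∀ u, u.Prime → u % 12 = 1 ∨ u % 12 = r → Q u) {A B C D n₀ : ℕ}
    (hA : 0 < A) (hC : 0 < C) (hN : 0 < A * n₀ + B) (K : ℕ) :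
    ∃ n ≥ K, ∃ u, Q u ∧ u % 60 = 1 ∧ A * n + B = (A * n₀ + B) * u ∧
      ∃ p, p.Prime ∧ p % 12 = r ∧ p ∣ C * n + D ∧ ¬ p ^ 2 ∣ C * n + D := by
  obtain ⟨N, hNdef⟩ : ∃ N, N = A * n₀ + B := ⟨_, rfl⟩
  rw [← hNdef] at hN ⊢
  have hr12 : r.Coprime 12 := by rcases hr with rfl | rfl <;> decide
  -- The choice `n = n₀ + 60 * N * s` gives `A * n + B = N * u` with `u = 1 + 60 * A * s`.
  suffices ∃ s ≥ K, Q (1 + 60 * A * s) ∧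
      ∃ p, p.Prime ∧ p % 12 = r ∧ p ∣ C * (n₀ + 60 * N * s) + D ∧
        ¬ p ^ 2 ∣ C * (n₀ + 60 * N * s) + D by
    obtain ⟨s, hs, h1, h2⟩ := this
    refine ⟨n₀ + 60 * N * s, by nlinarith, 1 + 60 * A * s, h1, ?_, ?_, h2⟩
    · rw [mul_assoc, Nat.add_mul_mod_self_left]
    · linear_combination -hNdef
  have hcop : ∀ {p m : ℕ}, p.Prime → 0 < m → m < p → p.Coprime m := fun {p m} hp h1 h2 =>
    hp.coprime_iff_not_dvd.2 fun h => absurd (Nat.le_of_dvd h1 h) (by omega)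
  have hlarge : ∀ s, 60 * A * K + 1 < 1 + 60 * A * s → K ≤ s := by
    intro s hs
    by_contra h
    have : 60 * A * s ≤ 60 * A * K := Nat.mul_le_mul_left _ (by omega)
    omega
  have hA0 : 0 < 60 * A := by omega
  by_cases hE : A * D = B * C
  -- The forms are proportional, so `C * n + D = L * u`. Take `u = v * w` with distinct primes `v >
  -- L` and `w`, where `w` inverts `v` modulo `60 * A`; as `r² ≡ 1` modulo 12, both are `r` modulo
  -- 12, and `v` divides `L * u` exactly once.
  · obtain ⟨L, hLdef⟩ : ∃ L, L = C * n₀ + D := ⟨_, rfl⟩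
    have hAL : A * L = C * N := by
      rw [hLdef, hNdef]
      linear_combination hE
    have hL : 0 < L := by
      rcases Nat.eq_zero_or_pos L with rfl | h
      · have := Nat.mul_pos hC hN
        omega
      · exact h
    obtain ⟨v, hv, hvp, hvr⟩ := Nat.forall_exists_prime_gt_and_modEq (60 * A + L) (q := 12)
      (by norm_num) hr12
    have hv12 : v % 12 = r := by
      have : v % 12 = r % 12 := hvr
      omega
    have hvA : v.Coprime (60 * A) := hcop hvp (by omega) (by omega)
    obtain ⟨m, -, hm⟩ := Nat.exists_mul_mod_eq_one_of_coprime hvA (by omega)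
    have hmA : m.Coprime (60 * A) := by
      refine Nat.Coprime.coprime_mul_left (k := v) ?_
      rw [Nat.Coprime, Nat.gcd_comm, Nat.gcd_rec, hm, Nat.gcd_one_left]
    obtain ⟨w, hw, hwp, hwm⟩ := Nat.forall_exists_prime_gt_and_modEq (60 * A * K + 1 + v)
      (q := 60 * A) (by omega) hmA
    have hvw : v * w % (60 * A) = 1 := by
      have h1 : v * w % (60 * A) = v * m % (60 * A) := Nat.ModEq.mul_left v hwm
      rw [h1, hm]
    have hw12 : w % 12 = r := by
      have h1 : v * w % (12 * (5 * A)) = 1 := by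
        rw [← hvw]
        congr 1
        ring
      have h2 : v * w % 12 = 1 := by
        rw [← Nat.mod_mod_of_dvd (v * w) (Dvd.intro (5 * A) rfl), h1]
      rw [Nat.mul_mod, hv12] at h2
      rcases hr with rfl | rfl <;> omega
    obtain ⟨s, hs⟩ : ∃ s, v * w = 1 + 60 * A * s := ⟨v * w / (60 * A), by
      rw [← hvw, Nat.mod_add_div]⟩
    have hkey : C * (n₀ + 60 * N * s) + D = v * (L * w) := by
      have h2 : 60 * (A * L) * s = 60 * (C * N) * s := by rw [hAL]
      linear_combination -hLdef - h2 - L * hs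
    refine ⟨s, hlarge s ?_, ?_, v, hvp, hv12, ?_, ?_⟩
    · rw [← hs]
      have := hvp.two_le
      nlinarith
    · rw [← hs]
      exact hmul _ _ (hQ v hvp (Or.inr hv12)) (hQ w hwp (Or.inr hw12))
    · exact hkey ▸ Dvd.intro _ rfl
    · rw [hkey, sq]
      intro h
      have h1 := Nat.dvd_of_mul_dvd_mul_left hvp.pos h
      rcases hvp.dvd_mul.1 h1 with h2 | h2
      · have := Nat.le_of_dvd hL h2
        omega
      · have := (Nat.prime_dvd_prime_iff_eq hvp hwp).1 h2
        omega
  -- Now `A * (C * n + D) = C * N * u + E` with `E ≠ 0`. It suffices to find a prime `u ≡ 1` modulo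
  -- `60 * A` for which the right side is `p` modulo `p²`.
  · obtain ⟨E, hEdef⟩ : ∃ E : ℤ, E = A * D - B * C := ⟨_, rfl⟩
    have hE0 : E ≠ 0 := by
      intro h
      rw [h] at hEdef
      exact hE (by zify; linear_combination -hEdef)
    obtain ⟨p, hpgt, hp, hpr⟩ := Nat.forall_exists_prime_gt_and_modEq
      (60 * A + C * N + E.natAbs) (q := 12) (by norm_num) hr12
    have hp12 : p % 12 = r := by
      have : p % 12 = r % 12 := hpr
      omega
    have hCN : 0 < C * N := Nat.mul_pos hC hN
    have hpA : IsCoprime ((60 * A : ℕ) : ℤ) ((p : ℤ) ^ 2) :=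
      (Nat.isCoprime_iff_coprime.2 (hcop hp (by omega) (by omega)).symm).pow_right
    have hpCN : IsCoprime ((C * N : ℕ) : ℤ) ((p : ℤ) ^ 2) :=
      (Nat.isCoprime_iff_coprime.2 (hcop hp (by omega) (by omega)).symm).pow_right
    have hpE : ¬ (p : ℤ) ∣ E := by
      intro h
      have := Nat.le_of_dvd (Int.natAbs_pos.2 hE0) (Int.natCast_dvd.1 h)
      omega
    have hpZ : Prime (p : ℤ) := Nat.prime_iff_prime_int.1 hp
    obtain ⟨α, β, hαβ⟩ := hpA
    obtain ⟨γ, δ, hγδ⟩ := hpCN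
    push_cast at hαβ hγδ
    -- Since `γ` inverts `C * N` modulo `p²`, `c₀` solves `C * N * c₀ ≡ p - E`. Then `c` combines
    -- `c₀` modulo `p²` with 1 modulo `60 * A` by the Chinese remainder theorem; it is prime to `p`
    -- because `C * N * c ≡ -E` modulo `p`.
    obtain ⟨c₀, hc₀⟩ : ∃ c₀ : ℤ, c₀ = (p - E) * γ := ⟨_, rfl⟩
    obtain ⟨c, hc⟩ : ∃ c : ℤ, c = β * p ^ 2 + c₀ * α * (60 * A) := ⟨_, rfl⟩
    have hpc : ¬ (p : ℤ) ∣ c := by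
      rintro ⟨e, he⟩
      apply hpE
      exact ⟨1 - C * N * (e - (1 - c₀) * β * p) - (p - E) * δ * p, by
        linear_combination C * N * (hc - he) + C * N * c₀ * hαβ + (p - E) * hγδ + C * N * hc₀⟩
    have hcq : IsCoprime c ((60 * A * p ^ 2 : ℕ) : ℤ) := by
      push_cast
      refine IsCoprime.mul_right ⟨1, -((c₀ - 1) * α), ?_⟩ ?_
      · linear_combination hc + hαβ
      · exact ((hpZ.coprime_iff_not_dvd).2 hpc).symm.pow_right
    obtain ⟨u, hu, hup, huc⟩ := Nat.forall_exists_prime_gt_and_zmodEq (60 * A * K + 1)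
      (q := 60 * A * p ^ 2) (Nat.mul_pos hA0 (pow_pos hp.pos 2)).ne' hcq
    obtain ⟨e, he⟩ := huc.symm.dvd
    push_cast at he
    have hu1 : (u : ℤ) = 1 + 60 * A * ((c₀ - 1) * α + p ^ 2 * e) := by
      linear_combination he + hc + hαβ
    obtain ⟨s, hs⟩ : ∃ s : ℕ, u = 1 + 60 * A * s := by
      have h1 : (0 : ℤ) ≤ (c₀ - 1) * α + p ^ 2 * e := by
        have := hup.two_le
        by_contra h
        have : (60 * A : ℤ) * ((c₀ - 1) * α + p ^ 2 * e) ≤ 0 :=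
          mul_nonpos_of_nonneg_of_nonpos (by positivity) (by omega)
        omega
      refine ⟨((c₀ - 1) * α + p ^ 2 * e).toNat, ?_⟩
      zify
      rw [Int.toNat_of_nonneg h1, hu1]
    have hkey : ∃ z : ℤ, (A : ℤ) * (C * (n₀ + 60 * N * s) + D : ℕ) = p + p ^ 2 * z := by
      refine ⟨C * N * ((1 - c₀) * β + 60 * A * e) - (p - E) * δ, ?_⟩
      zify at hs hNdef
      push_cast
      linear_combination -C * N * hs + C * N * he + C * N * hc + C * N * c₀ * hαβ - C * hNdef -
        hEdef + (p - E) * hγδ + C * N * hc₀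
    obtain ⟨z, hz⟩ := hkey
    refine ⟨s, hlarge s (hs ▸ hu), hs ▸ hQ u hup (Or.inl ?_), p, hp, hp12, ?_, ?_⟩
    · rw [hs, show 1 + 60 * A * s = 1 + 12 * (5 * A * s) by ring, Nat.add_mul_mod_self_left]
    · have h1 : (p : ℤ) ∣ (A : ℤ) * (C * (n₀ + 60 * N * s) + D : ℕ) :=
        ⟨1 + p * z, by rw [hz]; ring⟩
      rcases hpZ.dvd_or_dvd h1 with h2 | h2
      · have := Nat.le_of_dvd hA (Int.natCast_dvd_natCast.1 h2)
        omega
      · exact Int.natCast_dvd_natCast.1 h2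
    · rintro ⟨y, hy⟩
      rw [hy] at hz
      push_cast at hz
      have h1 : (p : ℤ) * (A * p * y - p * z) = p * 1 := by linear_combination hz
      have h2 := mul_left_cancel₀ (by exact_mod_cast hp.ne_zero) h1
      exact hpZ.not_dvd_one ⟨A * y - z, by rw [← h2]; ring⟩

/-! ### Separating the zeros and conclusion -/

theorem exists_selfConjCoreCount_ne_zero_coreCount_eq_zero {M₁ M₂ : ℕ} (hM₁ : 0 < M₁)
    (hM₂ : 0 < M₂) {m₁ m₂ n₀ : ℕ} (h : selfConjCoreCount 5 (M₂ * n₀ + m₂) ≠ 0) (K : ℕ) :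
    ∃ n ≥ K, selfConjCoreCount 5 (M₂ * n + m₂) ≠ 0 ∧ coreCount 3 (M₁ * n + m₁) = 0 := by
  obtain ⟨n, hn, u, ⟨x, y, hu⟩, hu60, hN, p, hp, hp12, hdvd, hndvd⟩ :=
    exists_large_progression (Q := fun u : ℕ => ∃ x y : ℤ, x ^ 2 + y ^ 2 = u) (r := 5)
      (A := M₂) (B := m₂ + 1) (C := 3 * M₁) (D := 3 * m₁ + 1) (n₀ := n₀)
      (by
        rintro u v ⟨a, b, hu⟩ ⟨c, d, hv⟩
        exact ⟨a * c - b * d, a * d + b * c, by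
          push_cast
          rw [← hu, ← hv]
          ring⟩)
      (Or.inl rfl)
      (by
        intro u hu h
        have : Fact u.Prime := ⟨hu⟩
        obtain ⟨a, b, hab⟩ := Nat.Prime.sq_add_sq (p := u) (by omega)
        exact ⟨a, b, by exact_mod_cast hab⟩)
      hM₂ (by omega) (by omega) K
  refine ⟨n, hn, ?_, ?_⟩
  · rw [selfConjCoreCount_five_ne_zero_iff] at h ⊢
    obtain ⟨a, b, hab⟩ := h
    obtain ⟨c, d, hcd⟩ := exists_rep_mul_sq_add_sq hab hu (by omega)
    refine ⟨c, d, ?_⟩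
    zify at hN
    push_cast at hcd ⊢
    linear_combination hcd - 5 * hN
  · by_contra h3
    obtain ⟨a, b, hab⟩ := (coreCount_three_ne_zero_iff _).1 h3
    refine hndvd (not_sq_dvd_of_eq_eisenstein_norm hp (by omega) hdvd (x := a) (y := b) ?_)
    rw [hab]
    push_cast
    ring

theorem exists_coreCount_ne_zero_selfConjCoreCount_eq_zero {M₁ M₂ : ℕ} (hM₁ : 0 < M₁)
    (hM₂ : 0 < M₂) {m₁ m₂ n₀ : ℕ} (h : coreCount 3 (M₁ * n₀ + m₁) ≠ 0) (K : ℕ) :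
    ∃ n ≥ K, coreCount 3 (M₁ * n + m₁) ≠ 0 ∧ selfConjCoreCount 5 (M₂ * n + m₂) = 0 := by
  obtain ⟨n, hn, u, ⟨x, y, hu⟩, hu60, hN, p, hp, hp12, hdvd, hndvd⟩ :=
    exists_large_progression (Q := fun u : ℕ => ∃ x y : ℤ, x ^ 2 + x * y + y ^ 2 = u) (r := 7)
      (A := 3 * M₁) (B := 3 * m₁ + 1) (C := M₂) (D := m₂ + 1) (n₀ := n₀)
      (by
        rintro u v ⟨a, b, hu⟩ ⟨c, d, hv⟩
        exact ⟨_, _, by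
          push_cast
          rw [← hu, ← hv]
          exact eisenstein_norm_mul.symm⟩)
      (Or.inr rfl) (fun u hu h => hu.eq_eisenstein_norm (by omega)) (by omega) hM₂ (by omega) K
  refine ⟨n, hn, ?_, ?_⟩
  · rw [coreCount_three_ne_zero_iff] at h ⊢
    obtain ⟨a, b, hab⟩ := h
    refine ⟨_, _, (eisenstein_norm_mul (a := a) (b := b) (x := x) (y := y)).symm.trans ?_⟩
    zify at hN
    rw [hab, hu]
    push_cast
    linear_combination -hN
  · by_contra h3
    obtain ⟨a, b, hab⟩ := (selfConjCoreCount_five_ne_zero_iff _).1 h3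
    have h5 : p ^ 2 ∣ 5 * (M₂ * n + (m₂ + 1)) :=
      sq_dvd_of_eq_sq_add_sq hp (by omega) (hdvd.mul_left 5) (x := 5 * a - 2) (y := 5 * b - 1) (by
        rw [hab]
        push_cast
        ring)
    have hp5 : p.Coprime 5 := (Nat.coprime_primes hp Nat.prime_five).2 (by omega)
    exact hndvd ((Nat.Coprime.pow_left 2 hp5).dvd_of_dvd_mul_left h5)

/-- Exact proportionality forces equal zero sets, and asymptotic equivalence forces them to agree
eventually, each sequence being eventually a multiple of the other. -/
theorem not_isMultipleEvenAsymptotically {f g : ℕ → ℕ} {k : ℤ} (hk : k ≠ 0)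
    (hne : ∃ n, f n ≠ 0 ∨ g n ≠ 0)
    (hf : ∀ n₀, f n₀ ≠ 0 → ∀ K, ∃ n ≥ K, f n ≠ 0 ∧ g n = 0)
    (hg : ∀ n₀, g n₀ ≠ 0 → ∀ K, ∃ n ≥ K, g n ≠ 0 ∧ f n = 0) :
    ¬ IsMultipleEvenAsymptotically f g k := by
  have hk' : (k : ℝ) ≠ 0 := by exact_mod_cast hk
  rintro (h | h | ⟨hfreq, h⟩)
  · obtain ⟨n₀, h0 | h0⟩ := hne
    · obtain ⟨n, -, h1, h2⟩ := hf n₀ h0 0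
      have := h n
      rw [h2] at this
      exact h1 (by simpa using this)
    · obtain ⟨n, -, h1, h2⟩ := hg n₀ h0 0
      have := h n
      rw [h2] at this
      simp [hk, h1] at this
  · have h' := h.symm
    obtain ⟨φ, -, hφ⟩ := h.exists_eq_mul
    obtain ⟨ψ, -, hψ⟩ := h'.exists_eq_mul
    obtain ⟨K, hK⟩ := Filter.eventually_atTop.1 (hφ.and hψ)
    obtain ⟨n₀, h0 | h0⟩ := hne
    · obtain ⟨n, hn, h1, h2⟩ := hf n₀ h0 K
      have := (hK n hn).1
      simp [h2, h1] at this
    · obtain ⟨n, hn, h1, h2⟩ := hg n₀ h0 K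
      have := (hK n hn).2
      simp [h2, h1, hk] at this
  -- The ratio says nothing at zeros of `g`, so only `hg` helps; its starting point comes from
  -- `hfreq`, and it makes the ratio 0 at arbitrarily large indices.
  · obtain ⟨n₀, h0⟩ := hfreq.exists
    have hev := h.eventually_ne hk'
    rw [Filter.eventually_inf_principal] at hev
    obtain ⟨K, hK⟩ := Filter.eventually_atTop.1 hev
    obtain ⟨n, hn, h1, h2⟩ := hg n₀ h0 K
    exact hK n hn h1 (by simp [h2])

theorem corollary5p2 (M₁ m₁ M₂ m₂ : ℕ) (hM₁ : 0 < M₁) (hM₂ : 0 < M₂)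
    (hne : ∃ n : ℕ, coreCount 3 (M₁ * n + m₁) ≠ 0 ∨ selfConjCoreCount 5 (M₂ * n + m₂) ≠ 0)
    (k : ℤ) (hk : k ≠ 0) :
    ¬ IsMultipleEvenAsymptotically
        (fun n => coreCount 3 (M₁ * n + m₁)) (fun n => selfConjCoreCount 5 (M₂ * n + m₂)) k ∧
    ¬ IsMultipleEvenAsymptotically
        (fun n => selfConjCoreCount 5 (M₂ * n + m₂)) (fun n => coreCount 3 (M₁ * n + m₁)) k :=
  ⟨not_isMultipleEvenAsymptotically hk hne
    (fun _ h => exists_coreCount_ne_zero_selfConjCoreCount_eq_zero hM₁ hM₂ h)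
    (fun _ h => exists_selfConjCoreCount_ne_zero_coreCount_eq_zero hM₁ hM₂ h),
  not_isMultipleEvenAsymptotically hk (hne.imp fun _ => Or.symm)
    (fun _ h => exists_selfConjCoreCount_ne_zero_coreCount_eq_zero hM₁ hM₂ h)
    (fun _ h => exists_coreCount_ne_zero_selfConjCoreCount_eq_zero hM₁ hM₂ h)⟩
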